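/- Let $k$ be a field which is either of characteristic $0$ or equal to $\mathbb{F}_p$ for a prime $p$. An affine group scheme $G$ over $k$ is given by its commutative Hopf algebra $\mathcal{O}(G)$ of regular functions, with $G(R)=\mathrm{Hom}_{k\text{-alg}}(\mathcal{O}(G),R)$. Call $G$ unipotent if $\mathcal{O}(G)$ is a finitely generated $k$-algebra and every nonzero linear representation of $G$ has a nonzero fixed vector, where for $k=\mathbb{F}_p$ one only admits the constant group schemes of finite $p$-groups; call $G$ prounipotent if it is an inverse limit of unipotent groups over a directed index set (so for $k=\mathbb{F}_p$ these are the pro-$p$-groups). A set $S\subseteq G(k)$ generates $G$ if its Zariski closure, i.e. the smallest closed subgroup $K$ of $G$ with $S\subseteq K(k)$, is $G$. Let $\mathrm{rank}(G)$ be the least number of elements of $G(k)$ that generate $G$ ($\infty$ if no finite set does). Let $f\colon G\to H$ be an epimorphism of prounipotent groups over $k$ (that is, $\mathcal{O}(H)\to\mathcal{O}(G)$ is injective), let $e\ge 0$ be an integer with $\mathrm{rank}(G)\le e$, and let $h_1,\dots,h_e\in H(k)$ generate $H$. Then there exist $g_1,\dots,g_e\in G(k)$ which generate $G$ and satisfy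 $f(g_i)=h_i$ for $i=1,\dots,e$. -/

import Mathlib

open scoped TensorProduct

universe u

/-!
Affine group schemes over a field `k` are represented by their commutative Hopf algebras of regular
functions `A = 𝒪(G)`, so that `G(R) = Hom_{k-alg}(A, R)`; homomorphisms `G ⟶ H` of affine group
schemes are the bialgebra homomorphisms `𝒪(H) ⟶ 𝒪(G)`.
-/

namespace AffGroup

/-- The group `G(k) = Hom_{k-alg}(𝒪(G), k)` of `k`-rational points, under convolution. -/
abbrev Points (k A : Type u) [Field k] [CommRing A] [HopfAlgebra k A] : Type u :=
  WithConv (A →ₐ[k] k)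

/-- The map `G(k) ⟶ H(k)` on rational points induced by a homomorphism `G ⟶ H`, which is given by
`φ : 𝒪(H) ⟶ 𝒪(G)`. -/
def mapPoints {k A B : Type u} [Field k] [CommRing A] [HopfAlgebra k A]
    [CommRing B] [HopfAlgebra k B] (φ : B →ₐc[k] A) (g : Points k A) : Points k B :=
  WithConv.toConv (g.ofConv.comp (φ : B →ₐ[k] A))

/-- A linear representation of `G` on `V`, given as a (right) comodule structure
`ρ : V ⟶ V ⊗ 𝒪(G)`. -/
structure IsRepresentation (k A : Type u) [Field k] [CommRing A] [HopfAlgebra k A]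
    {V : Type u} [AddCommGroup V] [Module k V] (ρ : V →ₗ[k] V ⊗[k] A) : Prop where
  coassoc : (TensorProduct.assoc k V A A).toLinearMap ∘ₗ ρ.rTensor A ∘ₗ ρ =
    (Coalgebra.comul (R := k) (A := A)).lTensor V ∘ₗ ρ
  counit : (TensorProduct.rid k V).toLinearMap ∘ₗ
    (Coalgebra.counit (R := k) (A := A)).lTensor V ∘ₗ ρ = LinearMap.id

/-- `G` is the constant group scheme of a finite `p`-group `Γ`: there is a group homomorphism
`Γ ⟶ G(k)` such that evaluation identifies `𝒪(G)` with the algebra of all functions `Γ ⟶ k`. -/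
def IsConstantPGroup (p : ℕ) (k A : Type u) [Field k] [CommRing A] [HopfAlgebra k A] : Prop :=
  ∃ (Γ : Type) (_ : Group Γ) (_ : Finite Γ) (θ : Γ →* Points k A), IsPGroup p Γ ∧
    Function.Bijective (fun (a : A) (γ : Γ) => (θ γ).ofConv a)

/-- Unipotent groups: `G` is algebraic (`𝒪(G)` is a finitely generated `k`-algebra) and each nonzero
representation has a nonzero fixed vector; over a prime field `k = 𝔽_p` one moreover restricts to
the constant group schemes of finite `p`-groups. -/
structure IsUnipotent (k A : Type u) [Field k] [CommRing A] [HopfAlgebra k A] : Prop where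
  algebraic : Algebra.FiniteType k A
  exists_fixed : ∀ (V : Type u) [AddCommGroup V] [Module k V] [Nontrivial V]
    (ρ : V →ₗ[k] V ⊗[k] A), IsRepresentation k A ρ → ∃ v : V, v ≠ 0 ∧ ρ v = v ⊗ₜ[k] (1 : A)
  constant : ∀ p : ℕ, p.Prime → Nat.card k = p → IsConstantPGroup p k A

/-- A decomposition `G = lim G_i` as an inverse limit, over a directed index set, of unipotent
groups. On regular functions this says that `𝒪(G)` is the direct limit of the `𝒪(G_i)`:
the last two fields characterise direct limits of algebras. -/
structure UnipotentDecomposition (k A : Type u) [Field k] [CommRing A] [HopfAlgebra k A] where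
  ι : Type u
  [preorder : Preorder ι]
  [nonempty : Nonempty ι]
  [directed : IsDirectedOrder ι]
  /-- the algebras `𝒪(G_i)` -/
  O : ι → Type u
  [commRing : ∀ i, CommRing (O i)]
  [hopfAlgebra : ∀ i, HopfAlgebra k (O i)]
  unipotent : ∀ i, IsUnipotent k (O i)
  /-- the maps given by the transition homomorphisms `G_j ⟶ G_i` -/
  trans : ∀ i j, i ≤ j → (O i →ₐc[k] O j)
  trans_self : ∀ i x, trans i i le_rfl x = x
  trans_trans : ∀ i j l (hij : i ≤ j) (hjl : j ≤ l) x,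
    trans j l hjl (trans i j hij x) = trans i l (hij.trans hjl) x
  /-- the maps given by the projections `G ⟶ G_i` -/
  proj : ∀ i, O i →ₐc[k] A
  proj_trans : ∀ i j (hij : i ≤ j) x, proj j (trans i j hij x) = proj i x
  exhaustive : ∀ a : A, ∃ i x, proj i x = a
  eventually_eq : ∀ i (x y : O i), proj i x = proj i y →
    ∃ j, ∃ hij : i ≤ j, trans i j hij x = trans i j hij y

/-- `G` is a prounipotent group: it is an inverse limit of unipotent groups. -/
def IsProunipotent (k A : Type u) [Field k] [CommRing A] [HopfAlgebra k A] : Prop :=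
  Nonempty (UnipotentDecomposition k A)

/-- `S ⊆ G(k)` generates `G`: each closed subgroup `K` of `G` with `S ⊆ K(k)` is all of `G`,
i.e. the Zariski closure of `S` is `G`. Closed subgroups `K` correspond to Hopf ideals `I` of `𝒪(G)`,
and a point lies in `K(k)` when it vanishes on `I`. -/
def Generates (k A : Type u) [Field k] [CommRing A] [HopfAlgebra k A] (S : Set (Points k A)) :
    Prop :=
  ∀ I : Ideal A, I.IsHopfIdeal k → (∀ s ∈ S, ∀ a ∈ I, s.ofConv a = 0) → I = ⊥

/-- The rank of `G`: the least number of rational points that generate `G` (`⊤` when no finite set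
does). -/
noncomputable def rank (k A : Type u) [Field k] [CommRing A] [HopfAlgebra k A] : ℕ∞ :=
  ⨅ (S : Set (Points k A)) (_ : Generates k A S), S.encard

end AffGroup

/-! Write `A` = 𝒪(G), `B` = 𝒪(H), and let P(G) be the space of primitive elements of `A`, i.e. the
additive characters of G. Two facts carry the proof.

Generation is detected on additive characters (`generates_range_iff`). The fixed-vector axiom makes
the Loewy series of the regular comodule exhaust `A`, and in such a Hopf algebra every nonzero
coideal contains a nonzero primitive element. Hence points generate G exactly when evaluation at
them is injective on P(G). So dim P(G) ≤ e, and the given h_i yield an injection P(H) → k^e, which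
extends to an injection l : P(G) → k^e by linear algebra.

Each point of H lifts to a point of G with prescribed values on P(G), provided these are compatible
on P(H). In characteristic 0 (`exists_lift_of_charZero`) the lift is the exponential of a tangent
vector, obtained by extending a linear functional and composing it with the logarithm of the
identity. Over 𝔽_p (`exists_lift_of_card_prime`) an arbitrary lift is corrected by a point of ker f.
Lifting each h_i with the values l_i gives the generators. -/

namespace AffGroup

open Coalgebra TensorProduct

/-! ### Contraction of tensors with functionals. -/

section Slices

variable {k V W X Y : Type*} [Field k] [AddCommGroup V] [Module k V] [AddCommGroup W] [Module k W]
  [AddCommGroup X] [Module k X] [AddCommGroup Y] [Module k Y]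

/-- Contraction of the right tensor factor with a functional. -/
noncomputable def rightSlice (V : Type*) [AddCommGroup V] [Module k V] (η : Module.Dual k W) :
    V ⊗[k] W →ₗ[k] V :=
  (TensorProduct.rid k V).toLinearMap ∘ₗ η.lTensor V

/-- Contraction of the left tensor factor with a functional. -/
noncomputable def leftSlice (W : Type*) [AddCommGroup W] [Module k W] (ξ : Module.Dual k V) :
    V ⊗[k] W →ₗ[k] W :=
  (TensorProduct.lid k W).toLinearMap ∘ₗ ξ.rTensor W

@[simp] lemma rightSlice_tmul (η : Module.Dual k W) (v : V) (w : W) :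
    rightSlice V η (v ⊗ₜ w) = η w • v := by
  simp [rightSlice]

@[simp] lemma leftSlice_tmul (ξ : Module.Dual k V) (v : V) (w : W) :
    leftSlice W ξ (v ⊗ₜ w) = ξ v • w := by
  simp [leftSlice]

lemma rightSlice_map (f : V →ₗ[k] X) (g : W →ₗ[k] Y) (η : Module.Dual k Y) (t : V ⊗[k] W) :
    rightSlice X η (map f g t) = f (rightSlice V (η ∘ₗ g) t) := by
  induction t with
  | zero => simp
  | tmul v w => simp
  | add s t hs ht => simp only [map_add, hs, ht]

lemma leftSlice_map (f : V →ₗ[k] X) (g : W →ₗ[k] Y) (ξ : Module.Dual k X) (t : V ⊗[k] W) :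
    leftSlice Y ξ (map f g t) = g (leftSlice W (ξ ∘ₗ f) t) := by
  induction t with
  | zero => simp
  | tmul v w => simp
  | add s t hs ht => simp only [map_add, hs, ht]

lemma eq_zero_of_rightSlice {t : V ⊗[k] W} (h : ∀ η : Module.Dual k W, rightSlice V η t = 0) :
    t = 0 := by
  classical
  let b := Module.Basis.ofVectorSpace k W
  apply (equivFinsuppOfBasisRight b).injective
  ext i
  rw [equivFinsuppOfBasisRight_apply]
  simpa [rightSlice] using h (b.coord i)

lemma eq_zero_of_leftSlice {t : V ⊗[k] W} (h : ∀ ξ : Module.Dual k V, leftSlice W ξ t = 0) :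
    t = 0 := by
  classical
  let b := Module.Basis.ofVectorSpace k V
  apply (equivFinsuppOfBasisLeft b).injective
  ext i
  rw [equivFinsuppOfBasisLeft_apply]
  simpa [leftSlice] using h (b.coord i)

lemma exists_fg_rightSlice_mem (t : V ⊗[k] W) :
    ∃ S : Submodule k V, S.FG ∧ (∀ η : Module.Dual k W, rightSlice V η t ∈ S) := by
  induction t with
  | zero => exact ⟨⊥, Submodule.fg_bot, by simp⟩
  | tmul v w =>
    refine ⟨k ∙ v, Submodule.fg_span_singleton v, fun η => ?_⟩
    simpa using Submodule.smul_mem _ _ (Submodule.mem_span_singleton_self v)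
  | add s t hs ht =>
    obtain ⟨S, hS, hS'⟩ := hs
    obtain ⟨T, hT, hT'⟩ := ht
    refine ⟨S ⊔ T, hS.sup hT, fun η => ?_⟩
    rw [map_add]
    exact Submodule.add_mem_sup (hS' η) (hT' η)

/-- If all right slices of `t` lie in the union of a chain of subspaces, then they all lie in one
member of the chain. -/
lemma exists_rightSlice_mem_of_iSup (F : ℕ → Submodule k V) (hF : Monotone F) (t : V ⊗[k] W)
    (h : ∀ η : Module.Dual k W, rightSlice V η t ∈ ⨆ n, F n) :
    ∃ n, ∀ η : Module.Dual k W, rightSlice V η t ∈ F n := by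
  let φ : Module.Dual k W →ₗ[k] V :=
    { toFun := fun η => rightSlice V η t
      map_add' := fun η η' => by
        simp [rightSlice, LinearMap.lTensor_add]
      map_smul' := fun c η => by
        simp [rightSlice, LinearMap.lTensor_smul] }
  -- The slices of one tensor span a finite-dimensional space, so finitely many members of the
  -- chain, hence one, suffice.
  obtain ⟨S, hS, hS'⟩ := exists_fg_rightSlice_mem t
  have hfin : Module.Finite k S := Module.Finite.iff_fg.mpr hS
  have hle : LinearMap.range φ ≤ S := by
    rintro _ ⟨η, rfl⟩
    exact hS' η
  have hfg : (LinearMap.range φ).FG := by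
    have := Submodule.finiteDimensional_of_le hle
    exact Module.Finite.iff_fg.mp this
  have hle' : LinearMap.range φ ≤ ⨆ n, F n := by
    rintro _ ⟨η, rfl⟩
    exact h η
  obtain ⟨s, hs⟩ := hfg
  have key : ∀ s : Finset V, (s : Set V) ⊆ (⨆ n, F n : Submodule k V) → ∃ n, (s : Set V) ⊆ F n := by
    classical
    intro s
    induction s using Finset.induction_on with
    | empty => exact fun _ => ⟨0, by simp⟩
    | insert a s _ ih =>
      intro hs
      rw [Finset.coe_insert, Set.insert_subset_iff] at hs
      obtain ⟨n, hn⟩ := ih hs.2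
      obtain ⟨m, hm⟩ := (Submodule.mem_iSup_of_directed F hF.directed_le).mp hs.1
      refine ⟨max m n, ?_⟩
      rw [Finset.coe_insert, Set.insert_subset_iff]
      exact ⟨hF (le_max_left m n) hm, hn.trans (hF (le_max_right m n))⟩
  obtain ⟨n, hn⟩ := key s (fun x hx => hle' (hs ▸ Submodule.subset_span hx))
  refine ⟨n, fun η => ?_⟩
  have : LinearMap.range φ ≤ F n := hs ▸ Submodule.span_le.mpr hn
  exact this ⟨η, rfl⟩

end Slices

/-! ### Translation operators and the Loewy series. -/

section Filtration

variable {k A B : Type*} [Field k] [CommRing A] [HopfAlgebra k A] [CommRing B] [HopfAlgebra k B]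

/-- The operator `a ↦ ∑ η(a₂) a₁`. -/
noncomputable def rightTranslate (η : Module.Dual k A) : A →ₗ[k] A :=
  rightSlice A η ∘ₗ comul

/-- The operator `a ↦ ∑ ξ(a₁) a₂`. -/
noncomputable def leftTranslate (ξ : Module.Dual k A) : A →ₗ[k] A :=
  leftSlice A ξ ∘ₗ comul

lemma rightTranslate_apply (η : Module.Dual k A) (a : A) :
    rightTranslate η a = rightSlice A η (comul a) := rfl

lemma leftTranslate_apply (ξ : Module.Dual k A) (a : A) :
    leftTranslate ξ a = leftSlice A ξ (comul a) := rfl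

/-- By coassociativity both sides contract the outer factors of the twofold comultiplication of `a`
with `ξ` and `η`. -/
lemma leftTranslate_rightTranslate (ξ η : Module.Dual k A) (a : A) :
    leftTranslate ξ (rightTranslate η a) = rightTranslate η (leftTranslate ξ a) := by
  have h1 : ∀ t : A ⊗[k] A, leftTranslate ξ (rightSlice A η t) =
      leftSlice A ξ ((rightSlice A η).lTensor A
        (TensorProduct.assoc k A A A (comul.rTensor A t))) := by
    intro t
    induction t with
    | zero => simp
    | add s t hs ht => simp only [map_add, hs, ht]
    | tmul x y =>
      have : ∀ s : A ⊗[k] A, η y • leftSlice A ξ s = leftSlice A ξ ((rightSlice A η).lTensor A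
          (TensorProduct.assoc k A A A (s ⊗ₜ y))) := by
        intro s
        induction s with
        | zero => simp
        | add s t hs ht => simp only [map_add, smul_add, hs, ht, TensorProduct.add_tmul]
        | tmul a b =>
          simp only [leftSlice_tmul, TensorProduct.assoc_tmul, LinearMap.lTensor_tmul,
            rightSlice_tmul]
          rw [smul_comm]
      simp [leftTranslate_apply, this]
  have h2 : ∀ t : A ⊗[k] A, rightTranslate η (leftSlice A ξ t) =
      leftSlice A ξ ((rightSlice A η).lTensor A (comul.lTensor A t)) := by
    intro t
    induction t with
    | zero => simp
    | add s t hs ht => simp only [map_add, hs, ht]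
    | tmul x y => simp [rightTranslate_apply]
  rw [rightTranslate_apply, h1, coassoc_apply, ← h2, leftTranslate_apply]

lemma counit_rightTranslate (η : Module.Dual k A) (a : A) :
    counit (R := k) (rightTranslate η a) = η a := by
  have h : ∀ t : A ⊗[k] A, counit (R := k) (rightSlice A η t) =
      η (leftSlice A (counit (R := k)) t) := by
    intro t
    induction t with
    | zero => simp
    | add s t hs ht => simp only [map_add, hs, ht]
    | tmul x y => simp [mul_comm]
  rw [rightTranslate_apply, h]
  simp [leftSlice]

lemma rightTranslate_bialgHom (φ : B →ₐc[k] A) (η : Module.Dual k A) (b : B) :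
    rightTranslate η (φ b) = φ (rightTranslate (η ∘ₗ (φ : B →ₗ[k] A)) b) := by
  have := CoalgHomClass.map_comp_comul_apply φ b
  rw [rightTranslate_apply, ← this, rightSlice_map]
  rfl

variable (k A) in
/-- The ascending Loewy series of the regular comodule, shifted so that it begins with `0` and
the scalars. -/
noncomputable def loewy : ℕ → Submodule k A
  | 0 => ⊥
  | n + 1 => ⨅ η : Module.Dual k A, (loewy n).comap (rightTranslate η - η 1 • LinearMap.id)

lemma mem_loewy_succ {n : ℕ} {a : A} :
    a ∈ loewy k A (n + 1) ↔
      ∀ η : Module.Dual k A, rightTranslate η a - η 1 • a ∈ loewy k A n := by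
  simp [loewy]

lemma loewy_mono : Monotone (loewy k A) := by
  apply monotone_nat_of_le_succ
  intro n
  induction n with
  | zero => exact bot_le
  | succ n ih =>
    intro a ha
    rw [mem_loewy_succ] at ha ⊢
    exact fun η => ih (ha η)

lemma rightTranslate_mem_loewy {n : ℕ} {a : A} (ha : a ∈ loewy k A n) (η : Module.Dual k A) :
    rightTranslate η a ∈ loewy k A n := by
  have h := mem_loewy_succ.mp (loewy_mono n.le_succ ha) η
  simpa using add_mem h (Submodule.smul_mem _ (η 1) ha)

lemma eq_algebraMap_of_mem_loewy_one {a : A} (ha : a ∈ loewy k A 1) :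
    a = algebraMap k A (counit (R := k) a) := by
  rw [← sub_eq_zero, ← Module.forall_dual_apply_eq_zero_iff k]
  intro η
  have h : rightTranslate η a - η 1 • a = 0 := by simpa [loewy] using mem_loewy_succ.mp ha η
  have := congrArg (counit (R := k)) h
  rw [map_sub, counit_rightTranslate] at this
  rw [map_sub, Algebra.algebraMap_eq_smul_one]
  simpa [mul_comm] using this

lemma one_mem_loewy (n : ℕ) : (1 : A) ∈ loewy k A (n + 1) :=
  mem_loewy_succ.mpr fun η => by simp [rightTranslate_apply, Algebra.TensorProduct.one_def]

/-- The series is defined by contractions on the right only. Since left and right translations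
commute, induction gives the left-handed bound, so that both factors of a comultiplication can be
controlled. -/
lemma leftTranslate_sub_mem_loewy {n : ℕ} {a : A} (ha : a ∈ loewy k A (n + 1))
    (ξ : Module.Dual k A) : leftTranslate ξ a - ξ 1 • a ∈ loewy k A n := by
  induction n generalizing a with
  | zero =>
    rw [eq_algebraMap_of_mem_loewy_one ha]
    simp only [leftTranslate_apply, Algebra.algebraMap_eq_smul_one, map_smul,
      Bialgebra.comul_one, Algebra.TensorProduct.one_def, leftSlice_tmul]
    rw [smul_comm, sub_self]
    exact zero_mem _
  | succ n ih =>
    rw [mem_loewy_succ]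
    intro η
    have := ih (mem_loewy_succ.mp ha η)
    convert this using 1
    simp only [map_sub, map_smul, leftTranslate_rightTranslate, smul_sub, smul_comm (ξ 1) (η 1)]
    abel

lemma bialgHom_mem_loewy (φ : B →ₐc[k] A) {n : ℕ} {b : B} (hb : b ∈ loewy k B n) :
    φ b ∈ loewy k A n := by
  induction n generalizing b with
  | zero =>
    have : b = 0 := by simpa [loewy] using hb
    simp [this]
  | succ n ih =>
    rw [mem_loewy_succ] at hb ⊢
    intro η
    have := ih (hb (η ∘ₗ (φ : B →ₗ[k] A)))
    rw [rightTranslate_bialgHom]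
    simpa using this

variable (k A) in
/-- The Loewy series exhausts the regular comodule. -/
def IsConilpotent : Prop := ∀ a : A, ∃ n, a ∈ loewy k A n

end Filtration

/-! ### Prounipotent groups have conilpotent Hopf algebras. -/

section Unipotent

variable {k A : Type u} [Field k] [CommRing A] [HopfAlgebra k A]

variable (k A) in
/-- The coaction on the quotient of the regular comodule by the union of its Loewy series. -/
noncomputable def quotientCoaction :
    (A ⧸ (⨆ n, loewy k A n)) →ₗ[k] (A ⧸ (⨆ n, loewy k A n)) ⊗[k] A :=
  (⨆ n, loewy k A n).liftQ ((⨆ n, loewy k A n).mkQ.rTensor A ∘ₗ comul) <| by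
    intro a ha
    rw [LinearMap.mem_ker]
    apply eq_zero_of_rightSlice
    intro η
    have := rightSlice_map (⨆ n, loewy k A n).mkQ LinearMap.id η (comul a)
    rw [LinearMap.comp_apply, LinearMap.rTensor, this, LinearMap.comp_id, Submodule.mkQ_apply,
      Submodule.Quotient.mk_eq_zero, ← rightTranslate_apply]
    rw [Submodule.mem_iSup_of_directed _ loewy_mono.directed_le] at ha ⊢
    exact ha.imp fun n hn => rightTranslate_mem_loewy hn η

lemma quotientCoaction_mkQ (a : A) :
    quotientCoaction k A ((⨆ n, loewy k A n).mkQ a) =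
      (⨆ n, loewy k A n).mkQ.rTensor A (comul a) := rfl

lemma isRepresentation_quotientCoaction : IsRepresentation k A (quotientCoaction k A) where
  coassoc := by
    apply Submodule.linearMap_qext
    ext a
    set q := (⨆ n, loewy k A n).mkQ
    have h1 : (quotientCoaction k A).rTensor A (q.rTensor A (comul a)) =
        (q.rTensor A).rTensor A (comul.rTensor A (comul a)) := by
      rw [← LinearMap.rTensor_comp_apply, ← LinearMap.rTensor_comp_apply]
      rfl
    have h2 : ∀ t : (A ⊗[k] A) ⊗[k] A,
        TensorProduct.assoc k _ A A ((q.rTensor A).rTensor A t) =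
          q.rTensor (A ⊗[k] A) (TensorProduct.assoc k A A A t) := by
      intro t
      have : (TensorProduct.assoc k _ A A).toLinearMap ∘ₗ (q.rTensor A).rTensor A =
          q.rTensor (A ⊗[k] A) ∘ₗ (TensorProduct.assoc k A A A).toLinearMap := by
        ext; simp
      exact LinearMap.congr_fun this t
    have h3 : (comul (R := k) (A := A)).lTensor _ (q.rTensor A (comul a)) =
        q.rTensor (A ⊗[k] A) (comul.lTensor A (comul a)) := by
      exact LinearMap.congr_fun ((LinearMap.lTensor_comp_rTensor ..).trans
        (LinearMap.rTensor_comp_lTensor ..).symm) _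
    simp only [LinearMap.comp_apply, LinearEquiv.coe_coe]
    rw [quotientCoaction_mkQ, h1, h2, coassoc_apply, h3]
  counit := by
    apply Submodule.linearMap_qext
    ext a
    set q := (⨆ n, loewy k A n).mkQ
    have h3 : (counit (R := k) (A := A)).lTensor _ (q.rTensor A (comul a)) =
        q.rTensor k (counit.lTensor A (comul a)) := by
      exact LinearMap.congr_fun ((LinearMap.lTensor_comp_rTensor ..).trans
        (LinearMap.rTensor_comp_lTensor ..).symm) _
    simp only [LinearMap.comp_apply, LinearEquiv.coe_coe]
    rw [quotientCoaction_mkQ, h3]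
    simp

/-- If the union of the series were proper, the quotient comodule would have a nonzero fixed vector.
A representative of it is translated into itself modulo the union, so it already lies in the union.
-/
lemma IsUnipotent.isConilpotent (h : IsUnipotent k A) : IsConilpotent k A := by
  suffices htop : (⨆ n, loewy k A n) = ⊤ by
    intro a
    rw [← Submodule.mem_iSup_of_directed _ loewy_mono.directed_le, htop]
    trivial
  by_contra hne
  have : Nontrivial (A ⧸ (⨆ n, loewy k A n)) := Submodule.Quotient.nontrivial_iff.mpr hne
  obtain ⟨v, hv, hv'⟩ := h.exists_fixed _ _ isRepresentation_quotientCoaction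
  obtain ⟨a, rfl⟩ := Submodule.mkQ_surjective _ v
  apply hv
  rw [Submodule.mkQ_apply, Submodule.Quotient.mk_eq_zero]
  have key : ∀ η : Module.Dual k A, rightSlice A η (comul a - a ⊗ₜ[k] (1 : A)) ∈
      ⨆ n, loewy k A n := by
    intro η
    rw [← Submodule.Quotient.mk_eq_zero, ← Submodule.mkQ_apply]
    have := rightSlice_map (⨆ n, loewy k A n).mkQ LinearMap.id η (comul a - a ⊗ₜ[k] (1 : A))
    rw [LinearMap.comp_id] at this
    rw [← this, map_sub, map_sub]
    rw [quotientCoaction_mkQ] at hv'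
    erw [hv']
    simp
  -- A single `n` must serve all `η` at once for `a` to lie in step `n + 1`.
  obtain ⟨n, hn⟩ := exists_rightSlice_mem_of_iSup _ loewy_mono _ key
  refine (Submodule.mem_iSup_of_directed _ loewy_mono.directed_le).mpr ⟨n + 1, ?_⟩
  rw [mem_loewy_succ]
  intro η
  simpa [rightTranslate_apply] using hn η

lemma IsProunipotent.isConilpotent (h : IsProunipotent k A) : IsConilpotent k A := by
  obtain ⟨D⟩ := h
  intro a
  obtain ⟨i, x, rfl⟩ := D.exhaustive a
  let _ := D.commRing i
  let _ := D.hopfAlgebra i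
  obtain ⟨n, hn⟩ := (D.unipotent i).isConilpotent x
  exact ⟨n, bialgHom_mem_loewy (D.proj i) hn⟩

end Unipotent

/-! ### Primitive elements and coideals. -/

section Primitive

variable {k A B : Type*} [Field k] [CommRing A] [HopfAlgebra k A] [CommRing B] [HopfAlgebra k B]

variable (k A) in
/-- The space of primitive elements of `𝒪(G)`, i.e. of homomorphisms from `G` to the additive
group. -/
noncomputable def primitives : Submodule k A :=
  LinearMap.ker (comul (R := k) (A := A) -
    ((TensorProduct.mk k A A).flip 1 + TensorProduct.mk k A A 1))

lemma mem_primitives {x : A} :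
    x ∈ primitives k A ↔ comul (R := k) x = x ⊗ₜ[k] (1 : A) + (1 : A) ⊗ₜ[k] x := by
  simp [primitives, LinearMap.mem_ker, sub_eq_zero]

lemma counit_of_mem_primitives {x : A} (hx : x ∈ primitives k A) : counit (R := k) x = 0 := by
  have h := rTensor_counit_comul (R := k) x
  rw [mem_primitives.mp hx] at h
  have := congrArg (TensorProduct.lid k A) h
  have h2 : counit (R := k) x • (1 : A) = 0 := by simpa using this
  simpa using congrArg (counit (R := k)) h2

lemma antipode_of_mem_primitives {x : A} (hx : x ∈ primitives k A) :
    HopfAlgebra.antipode k x = -x := by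
  have h := HopfAlgebra.mul_antipode_rTensor_comul_apply (R := k) x
  rw [mem_primitives.mp hx, counit_of_mem_primitives hx] at h
  have h2 : HopfAlgebra.antipode k x + x = 0 := by simpa using h
  exact eq_neg_of_add_eq_zero_left h2

lemma map_mem_primitives (f : B →ₐc[k] A) {x : B} (hx : x ∈ primitives k B) :
    f x ∈ primitives k A := by
  have h := CoalgHomClass.map_comp_comul_apply f x
  rw [mem_primitives] at hx ⊢
  rw [← h, hx]
  simp

/-- Over a field `f ⊗ f` is again injective. Hence the characters of G that come from functions on H
are characters of H. -/
lemma mem_primitives_of_map_mem {f : B →ₐc[k] A} (hf : Function.Injective f) {x : B}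
    (hx : f x ∈ primitives k A) : x ∈ primitives k B := by
  have h := CoalgHomClass.map_comp_comul_apply f x
  rw [mem_primitives] at hx ⊢
  have hinj : Function.Injective
      (TensorProduct.map (f : B →ₗ[k] A) (f : B →ₗ[k] A)) :=
    TensorProduct.map_injective_of_flat_flat _ _ hf hf
  apply hinj
  rw [hx] at h
  erw [h]
  simp

lemma span_primitive_isHopfIdeal {x : A} (hx : x ∈ primitives k A) :
    (Ideal.span {x}).IsHopfIdeal k where
  counit_eq_zero a ha := by
    obtain ⟨b, rfl⟩ := Ideal.mem_span_singleton'.mp ha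
    simp [counit_of_mem_primitives hx]
  map_mkQ_comul_eq_zero a ha := by
    obtain ⟨b, rfl⟩ := Ideal.mem_span_singleton'.mp ha
    set I := Ideal.span {x}
    have hmem : ∀ y : A, y * x ∈ I := fun y => I.mul_mem_left y (Ideal.mem_span_singleton_self x)
    have key : ∀ t : A ⊗[k] A, TensorProduct.map (I.restrictScalars k).mkQ
        (I.restrictScalars k).mkQ (t * comul x) = 0 := by
      intro t
      induction t with
      | zero => simp
      | add s t hs ht => rw [add_mul, map_add, hs, ht, add_zero]
      | tmul y z =>
        have h1 : (I.restrictScalars k).mkQ (y * x) = 0 := by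
          rw [Submodule.mkQ_apply, Submodule.Quotient.mk_eq_zero]; exact hmem y
        have h2 : (I.restrictScalars k).mkQ (z * x) = 0 := by
          rw [Submodule.mkQ_apply, Submodule.Quotient.mk_eq_zero]; exact hmem z
        rw [mem_primitives.mp hx, mul_add, Algebra.TensorProduct.tmul_mul_tmul,
          Algebra.TensorProduct.tmul_mul_tmul, map_add, TensorProduct.map_tmul,
          TensorProduct.map_tmul, h1, h2, TensorProduct.zero_tmul, TensorProduct.tmul_zero,
          add_zero]
    rw [Bialgebra.comul_mul]
    exact key _
  antipode_mem a ha := by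
    obtain ⟨b, rfl⟩ := Ideal.mem_span_singleton'.mp ha
    rw [HopfAlgebra.antipode_mul_distrib, antipode_of_mem_primitives hx]
    exact Ideal.mul_mem_left _ _ (neg_mem (Ideal.mem_span_singleton_self x))

/-- A coideal of a conilpotent Hopf algebra that contains no nonzero primitive element is zero. -/
lemma eq_bot_of_isCoideal (hA : IsConilpotent k A) (I : Submodule k A) [I.IsCoideal]
    (hI : ∀ x ∈ I, x ∈ primitives k A → x = 0) : I = ⊥ := by
  suffices h : ∀ n, ∀ a ∈ loewy k A n, a ∈ I → a = 0 by
    rw [Submodule.eq_bot_iff]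
    intro a ha
    obtain ⟨n, hn⟩ := hA a
    exact h n a hn ha
  intro n
  induction n with
  | zero => exact fun a ha _ => by simpa [loewy] using ha
  | succ n ih =>
    intro a ha haI
    have hε : counit (R := k) a = 0 := Submodule.IsCoideal.counit_eq_zero haI
    -- In step 1 the element is a scalar with counit zero. From step 2 on, the scalars lie in the
    -- preceding step, as needed for `hr` and `hl`.
    rcases n with _ | n
    · rw [eq_algebraMap_of_mem_loewy_one ha, hε, map_zero]
    apply hI a haI
    rw [mem_primitives, ← sub_eq_zero]
    -- The reduced comultiplication `y` dies in A/I ⊗ A/I and has all its slices in step `n + 1`,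
    -- where `I` is zero by induction. Contracting one factor at a time, the projection A → A/I can
    -- therefore be removed from each factor, so `y = 0`.
    set y : A ⊗[k] A := comul a - (a ⊗ₜ[k] (1 : A) + (1 : A) ⊗ₜ[k] a) with hy
    have hπa : I.mkQ a = 0 := by simpa using haI
    have hπ : map I.mkQ I.mkQ y = 0 := by
      rw [hy, map_sub, map_add, Submodule.IsCoideal.map_mkQ_comul_eq_zero haI]
      simp only [_root_.TensorProduct.map_tmul, hπa]
      simp
    have hr : ∀ η : Module.Dual k A, rightSlice A η y ∈ loewy k A (n + 1) := by
      intro η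
      have : rightSlice A η y = (rightTranslate η a - η 1 • a) - η a • 1 := by
        simp [hy, rightTranslate_apply, sub_sub]
      rw [this]
      exact sub_mem (mem_loewy_succ.mp ha η) (Submodule.smul_mem _ _ (one_mem_loewy n))
    have hl : ∀ ξ : Module.Dual k A, leftSlice A ξ y ∈ loewy k A (n + 1) := by
      intro ξ
      have : leftSlice A ξ y = (leftTranslate ξ a - ξ 1 • a) - ξ a • 1 := by
        simp only [hy, leftTranslate_apply, map_sub, map_add, leftSlice_tmul]
        abel
      rw [this]
      exact sub_mem (leftTranslate_sub_mem_loewy ha ξ)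
        (Submodule.smul_mem _ _ (one_mem_loewy n))
    have hy' : map LinearMap.id I.mkQ y = 0 := by
      apply eq_zero_of_rightSlice
      intro η
      rw [rightSlice_map, LinearMap.id_apply]
      apply ih _ (hr _)
      have := rightSlice_map I.mkQ I.mkQ η y
      rw [hπ, map_zero] at this
      simpa using this.symm
    apply eq_zero_of_leftSlice
    intro ξ
    apply ih _ (hl _)
    have := leftSlice_map LinearMap.id I.mkQ ξ y
    rw [hy', map_zero, LinearMap.comp_id] at this
    simpa using this.symm

end Primitive

/-! ### Generation and rank in terms of additive characters. -/

section Generation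

variable {k A : Type u} [Field k] [CommRing A] [HopfAlgebra k A]

/-- A set of rational points that generates `G` separates the additive characters of `G` from
zero. -/
lemma Generates.eq_zero_of_mem_primitives {S : Set (Points k A)} (hS : Generates k A S) {x : A}
    (hx : x ∈ primitives k A) (h : ∀ s ∈ S, s.ofConv x = 0) : x = 0 := by
  have := hS (Ideal.span {x}) (span_primitive_isHopfIdeal hx) fun s hs a ha => by
    obtain ⟨b, rfl⟩ := Ideal.mem_span_singleton'.mp ha
    rw [map_mul, h s hs, mul_zero]
  exact Ideal.span_singleton_eq_bot.mp this

lemma generates_of_primitives (hA : IsConilpotent k A) {S : Set (Points k A)}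
    (h : ∀ x ∈ primitives k A, (∀ s ∈ S, s.ofConv x = 0) → x = 0) : Generates k A S := by
  intro I hI hIS
  have := hI.toIsCoideal
  have hbot := eq_bot_of_isCoideal hA (I.restrictScalars k)
    fun x hx hxp => h x hxp fun s hs => hIS s hs x hx
  exact (Submodule.restrictScalars_eq_bot_iff k A A).mp hbot

/-- Evaluation of additive characters at a family of rational points. -/
noncomputable def evalPrimitives {ι : Type*} (g : ι → Points k A) : primitives k A →ₗ[k] (ι → k) :=
  LinearMap.pi fun i => (g i).ofConv.toLinearMap ∘ₗ (primitives k A).subtype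

@[simp] lemma evalPrimitives_apply {ι : Type*} (g : ι → Points k A) (x : primitives k A) (i : ι) :
    evalPrimitives g x i = (g i).ofConv (x : A) := rfl

/-- A primitive element killed by all the points spans a Hopf ideal, i.e. defines a closed subgroup
containing them. Conversely, a nonzero Hopf ideal vanishing at the points contains a nonzero
primitive element by conilpotency. -/
lemma generates_range_iff (hA : IsConilpotent k A) {ι : Type*} (g : ι → Points k A) :
    Generates k A (Set.range g) ↔ Function.Injective (evalPrimitives g) := by
  rw [injective_iff_map_eq_zero]
  constructor
  · intro h x hx
    apply Subtype.ext
    refine h.eq_zero_of_mem_primitives x.2 ?_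
    rintro _ ⟨i, rfl⟩
    exact congrFun hx i
  · intro h
    refine generates_of_primitives hA fun x hx hxS => ?_
    have := h ⟨x, hx⟩ (funext fun i => hxS _ ⟨i, rfl⟩)
    exact congrArg Subtype.val this

lemma exists_generates_of_rank_le {e : ℕ} (h : rank k A ≤ e) :
    ∃ S : Set (Points k A), Generates k A S ∧ S.encard ≤ e := by
  by_contra! hcon
  have : ((e + 1 : ℕ) : ℕ∞) ≤ rank k A := by
    refine le_iInf₂ fun S hS => ?_
    have := Order.add_one_le_of_lt (hcon S hS)
    exact_mod_cast this
  have h2 := this.trans h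
  rw [Nat.cast_le] at h2
  omega

lemma finite_primitives_of_rank_le (hA : IsConilpotent k A) {e : ℕ} (h : rank k A ≤ e) :
    Module.Finite k (primitives k A) ∧ Module.finrank k (primitives k A) ≤ e := by
  obtain ⟨S, hS, hcard⟩ := exists_generates_of_rank_le h
  have hfin : S.Finite := Set.finite_of_encard_le_coe hcard
  have := hfin.fintype
  have hinj : Function.Injective (evalPrimitives ((↑) : S → Points k A)) := by
    rw [← generates_range_iff hA, Subtype.range_coe]
    exact hS
  refine ⟨Module.Finite.of_injective _ hinj,
    (LinearMap.finrank_le_finrank_of_injective hinj).trans ?_⟩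
  rw [Module.finrank_fintype_fun_eq_card, ← Set.toFinset_card]
  rwa [Set.encard_eq_coe_toFinset_card, Nat.cast_le] at hcard

end Generation

/-! ### Extension of linear maps and functionals. -/

section LinearAlgebra

variable {k U V W : Type*} [Field k] [AddCommGroup U] [Module k U] [AddCommGroup V] [Module k V]
  [AddCommGroup W] [Module k W]

/-- Extension of an injective map along an injective map, when the target is large enough. -/
lemma exists_injective_extension [FiniteDimensional k V] [FiniteDimensional k W]
    (hVW : Module.finrank k V ≤ Module.finrank k W) {i : U →ₗ[k] V} (hi : Function.Injective i)
    {h : U →ₗ[k] W} (hh : Function.Injective h) :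
    ∃ l : V →ₗ[k] W, Function.Injective l ∧ l ∘ₗ i = h := by
  obtain ⟨V', hV'⟩ := Submodule.exists_isCompl (LinearMap.range i)
  obtain ⟨W', hW'⟩ := Submodule.exists_isCompl (LinearMap.range h)
  have hle : Module.finrank k V' ≤ Module.finrank k W' := by
    have h1 := Submodule.finrank_add_eq_of_isCompl hV'
    have h2 := Submodule.finrank_add_eq_of_isCompl hW'
    rw [LinearMap.finrank_range_of_inj hi] at h1
    rw [LinearMap.finrank_range_of_inj hh] at h2
    omega
  obtain ⟨j, hj⟩ := finrank_le_iff_exists_linearMap.mp hle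
  let α : LinearMap.range i →ₗ[k] W := h ∘ₗ (LinearEquiv.ofInjective i hi).symm.toLinearMap
  let l := LinearMap.ofIsCompl hV' α (W'.subtype ∘ₗ j)
  have hl : ∀ u v, l (i u + (v : V')) = h u + j v := by
    intro u v
    have : i u = ((LinearEquiv.ofInjective i hi u : LinearMap.range i) : V) := rfl
    rw [map_add]
    congr 1
    · rw [this, LinearMap.ofIsCompl_apply_left]
      simp [α]
    · exact LinearMap.ofIsCompl_apply_right hV' v
  refine ⟨l, ?_, ?_⟩
  · rw [injective_iff_map_eq_zero]
    intro x hx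
    obtain ⟨⟨_, ⟨u, rfl⟩⟩, v, rfl⟩ : ∃ a : LinearMap.range i, ∃ b : V', (a : V) + b = x := by
      have := hV'.sup_eq_top ▸ Submodule.mem_top (x := x)
      obtain ⟨a, ha, b, hb, hab⟩ := Submodule.mem_sup.mp this
      exact ⟨⟨a, ha⟩, ⟨b, hb⟩, hab⟩
    rw [hl] at hx
    have h1 : h u = ((-(j v) : W') : W) := by
      rw [Submodule.coe_neg]; exact eq_neg_of_add_eq_zero_left hx
    have h2 : h u = 0 := by
      have : h u ∈ LinearMap.range h ⊓ W' := ⟨⟨u, rfl⟩, h1 ▸ (-(j v)).2⟩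
      rwa [hW'.inf_eq_bot, Submodule.mem_bot] at this
    have h3 : j v = 0 := by
      rw [h2, zero_add] at hx
      exact Subtype.ext hx
    rw [(map_eq_zero_iff h hh).mp h2, (map_eq_zero_iff j hj).mp h3]
    simp
  · ext u
    simpa using hl u 0

/-- A functional that vanishes on the kernel of a linear map factors through that map. -/
lemma exists_dual_comp_eq (m : V →ₗ[k] W) (ν : Module.Dual k V)
    (h : ∀ v, m v = 0 → ν v = 0) : ∃ ν' : Module.Dual k W, ν' ∘ₗ m = ν := by
  have : ν ∈ LinearMap.range m.dualMap := by
    rw [LinearMap.range_dualMap_eq_dualAnnihilator_ker, Submodule.mem_dualAnnihilator]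
    exact fun v hv => h v hv
  exact this

/-- Functionals on the source of an injective map and on a subspace of its target have a common
extension when they agree on the intersection. -/
lemma exists_dual_extension {i : U →ₗ[k] V} (hi : Function.Injective i) (S : Submodule k V)
    (α : Module.Dual k U) (β : Module.Dual k S)
    (h : ∀ (u : U) (s : S), i u = s → α u = β s) :
    ∃ l : Module.Dual k V, l ∘ₗ i = α ∧ l ∘ₗ S.subtype = β := by
  obtain ⟨r, hr⟩ := LinearMap.exists_leftInverse_of_injective i (LinearMap.ker_eq_bot.mpr hi)
  have hr' : ∀ u, r (i u) = u := LinearMap.congr_fun hr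
  -- The extension `α ∘ r` may differ from `β` on `S`. The difference vanishes on S ∩ im i, so it
  -- comes from a functional on V / im i, and adding that does not disturb the values on im i.
  obtain ⟨ν, hν⟩ := exists_dual_comp_eq ((LinearMap.range i).mkQ ∘ₗ S.subtype)
    (β - α ∘ₗ r ∘ₗ S.subtype) (by
      intro s hs
      rw [LinearMap.comp_apply, Submodule.mkQ_apply, Submodule.Quotient.mk_eq_zero] at hs
      obtain ⟨u, hu⟩ := hs
      have := h u s hu
      simp only [LinearMap.sub_apply, LinearMap.comp_apply, ← hu, hr', this, sub_self])
  refine ⟨α ∘ₗ r + ν ∘ₗ (LinearMap.range i).mkQ, ?_, ?_⟩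
  · ext u
    have : (LinearMap.range i).mkQ (i u) = 0 := by simp
    simp [hr', this]
  · ext s
    have := LinearMap.congr_fun hν s
    simp only [LinearMap.comp_apply, LinearMap.sub_apply] at this
    simp only [LinearMap.comp_apply, LinearMap.add_apply, this]
    abel

end LinearAlgebra

open Polynomial WithConv

/-! ### Convolution powers and polynomial interpolation. -/

section Nilpotence

variable {k A B R : Type*} [Field k] [CommRing A] [HopfAlgebra k A] [CommRing B] [HopfAlgebra k B]
  [CommRing R] [Algebra k R]

/-- Convolution powers of a map that kills `1` vanish on the Loewy series. -/
lemma convPow_eq_zero (φ : WithConv (A →ₗ[k] R)) (h1 : φ.ofConv 1 = 0) {n m : ℕ} (hnm : n ≤ m)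
    {a : A} (ha : a ∈ loewy k A n) : (φ ^ m).ofConv a = 0 := by
  induction n generalizing a m with
  | zero =>
    have : a = 0 := by simpa [loewy] using ha
    simp [this]
  | succ n ih =>
    obtain ⟨m, rfl⟩ : ∃ m', m = m' + 1 := ⟨m - 1, by omega⟩
    -- As `φ` kills 1, subtracting `a ⊗ 1` does not change the convolution product, and it moves the
    -- right slices one step down.
    have h : map (φ ^ m).ofConv LinearMap.id (comul a - a ⊗ₜ[k] (1 : A)) = 0 := by
      apply eq_zero_of_rightSlice
      intro η
      rw [rightSlice_map, LinearMap.comp_id]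
      apply ih (by omega)
      simpa [rightTranslate_apply] using mem_loewy_succ.mp ha η
    have hcomp : map (φ ^ m).ofConv φ.ofConv =
        map LinearMap.id φ.ofConv ∘ₗ map (φ ^ m).ofConv (LinearMap.id : A →ₗ[k] A) := by
      rw [← TensorProduct.map_comp, LinearMap.id_comp, LinearMap.comp_id]
    have h2 : map (φ ^ m).ofConv φ.ofConv (comul a - a ⊗ₜ[k] (1 : A)) = 0 := by
      rw [hcomp, LinearMap.comp_apply, h, map_zero]
    rw [map_sub, _root_.TensorProduct.map_tmul, h1, tmul_zero, sub_zero] at h2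
    rw [pow_succ, LinearMap.convMul_apply, h2, map_zero]

lemma convMul_bialgHom (f : B →ₐc[k] A) (φ ψ : WithConv (A →ₗ[k] R)) (b : B) :
    (φ * ψ).ofConv (f b) = (toConv (φ.ofConv ∘ₗ (f : B →ₗ[k] A)) *
      toConv (ψ.ofConv ∘ₗ (f : B →ₗ[k] A))).ofConv b :=
  LinearMap.congr_fun (LinearMap.convMul_comp_coalgHom_distrib φ ψ (f : B →ₗc[k] A)) b

lemma convPow_bialgHom (f : B →ₐc[k] A) (φ : WithConv (A →ₗ[k] R)) (n : ℕ) (b : B) :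
    (φ ^ n).ofConv (f b) = (toConv (φ.ofConv ∘ₗ (f : B →ₗ[k] A)) ^ n).ofConv b := by
  induction n generalizing b with
  | zero => simp
  | succ n ih =>
    rw [pow_succ, pow_succ, convMul_bialgHom]
    congr 3
    ext x
    exact ih x

lemma algHom_convPow {S : Type*} [CommRing S] [Algebra k S] (h : R →ₐ[k] S)
    (φ : WithConv (A →ₗ[k] R)) (n : ℕ) (a : A) :
    h ((φ ^ n).ofConv a) = (toConv (h.toLinearMap ∘ₗ φ.ofConv) ^ n).ofConv a := by
  induction n generalizing a with
  | zero => simp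
  | succ n ih =>
    rw [pow_succ, pow_succ]
    have := LinearMap.congr_fun (LinearMap.algHom_comp_convMul_distrib h (φ ^ n) φ) a
    refine this.trans ?_
    congr 3
    ext x
    exact ih x

lemma convMul_of_mem_primitives (φ ψ : WithConv (A →ₗ[k] R)) {x : A} (hx : x ∈ primitives k A) :
    (φ * ψ).ofConv x = φ.ofConv x * ψ.ofConv 1 + φ.ofConv 1 * ψ.ofConv x := by
  rw [LinearMap.convMul_apply, mem_primitives.mp hx]
  simp

/-- A locally finite family of linear maps is the family of coefficients of a linear map to
polynomials. -/
lemma exists_polynomial_coeff {V : Type*} [AddCommGroup V] [Module k V] (φ : ℕ → V →ₗ[k] R)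
    (h : ∀ v, ∃ N, ∀ n, N ≤ n → φ n v = 0) :
    ∃ P : V →ₗ[k] R[X], ∀ v n, (P v).coeff n = φ n v := by
  have h' : ∀ v, ∃ P : R[X], ∀ n, P.coeff n = φ n v := by
    intro v
    obtain ⟨N, hN⟩ := h v
    refine ⟨∑ i ∈ Finset.range N, monomial i (φ i v), fun n => ?_⟩
    rw [finsetSum_coeff]
    simp only [coeff_monomial]
    rw [Finset.sum_ite_eq' (Finset.range N) n]
    split_ifs with hn
    · rfl
    · exact (hN n (by simpa using hn)).symm
  choose P hP using h'
  refine ⟨{ toFun := P, map_add' := fun v w => ?_, map_smul' := fun c v => ?_ }, hP⟩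
  · ext n; simp [hP]
  · ext n; simp [hP]

/-- A polynomial over an algebra over a field of characteristic zero is determined by its values
at the natural numbers. -/
lemma polynomial_ext_of_eval_nat [CharZero k] {P Q : R[X]}
    (h : ∀ m : ℕ, P.eval (m : R) = Q.eval (m : R)) : P = Q := by
  rw [← sub_eq_zero]
  have h0 : ∀ m : ℕ, (P - Q).eval (m : R) = 0 := fun m => by rw [eval_sub, h, sub_self]
  generalize P - Q = T at h0
  ext n
  rw [coeff_zero, ← Module.forall_dual_apply_eq_zero_iff k]
  intro ξ
  -- A functional on the coefficients reduces the claim to a polynomial over the field `k` with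
  -- infinitely many roots.
  let q : k[X] := ∑ i ∈ Finset.range (T.natDegree + 1), monomial i (ξ (T.coeff i))
  have hq : ∀ m : ℕ, q.eval (m : k) = 0 := by
    intro m
    have := congrArg ξ (h0 m)
    rw [eval_eq_sum_range, map_sum, map_zero] at this
    rw [eval_finsetSum, ← this]
    refine Finset.sum_congr rfl fun i _ => ?_
    rw [eval_monomial, ← Nat.cast_pow, ← Nat.cast_pow, mul_comm (T.coeff i), ← nsmul_eq_mul,
      map_nsmul, nsmul_eq_mul, mul_comm]
  have hq0 : q = 0 := by
    apply eq_zero_of_infinite_isRoot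
    refine Set.Infinite.mono ?_ (Set.infinite_range_of_injective (Nat.cast_injective (R := k)))
    rintro _ ⟨m, rfl⟩
    exact hq m
  by_cases hn : n ≤ T.natDegree
  · have := congrArg (fun r => r.coeff n) hq0
    simp only [q, finsetSum_coeff, coeff_monomial, coeff_zero] at this
    rw [Finset.sum_ite_eq' (Finset.range (T.natDegree + 1)) n] at this
    rwa [if_pos (by simpa [Nat.lt_succ_iff] using hn)] at this
  · rw [coeff_eq_zero_of_natDegree_lt (by omega), map_zero]

end Nilpotence

/-! ### Adams operations and the logarithm of the identity (characteristic 0). -/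

section Adams

variable {k A B : Type*} [Field k] [CommRing A] [HopfAlgebra k A] [CommRing B] [HopfAlgebra k B]

variable (k A) in
/-- The Adams operation `a ↦ ∑ a₁ ⋯ aₘ`, which corresponds to the `m`-th power map on `G`. -/
noncomputable def adams (m : ℕ) : A →ₐ[k] A := (toConv (AlgHom.id k A) ^ m).ofConv

lemma adams_eq_convPow (m : ℕ) :
    toConv (adams k A m).toLinearMap = (toConv LinearMap.id : WithConv (A →ₗ[k] A)) ^ m :=
  AlgHom.toLinearMap_convPow _ m

lemma adams_apply (m : ℕ) (a : A) :
    adams k A m a = ((toConv LinearMap.id : WithConv (A →ₗ[k] A)) ^ m).ofConv a := by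
  rw [← adams_eq_convPow]; rfl

lemma adams_zero (a : A) : adams k A 0 a = algebraMap k A (counit a) := by
  simp [adams_apply]

lemma adams_one (a : A) : adams k A 1 a = a := by
  simp [adams_apply]

lemma adams_add (m n : ℕ) (a : A) : adams k A (m + n) a =
    (toConv (adams k A m).toLinearMap * toConv (adams k A n).toLinearMap).ofConv a := by
  rw [adams_eq_convPow, adams_eq_convPow, ← pow_add, adams_apply]

lemma adams_bialgHom (f : B →ₐc[k] A) (m : ℕ) (b : B) : adams k A m (f b) = f (adams k B m b) := by
  rw [adams_apply, adams_apply, convPow_bialgHom]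
  exact (algHom_convPow (f : B →ₐ[k] A) (toConv LinearMap.id) m b).symm

lemma adams_of_mem_primitives {x : A} (hx : x ∈ primitives k A) (m : ℕ) :
    adams k A m x = m * x := by
  induction m with
  | zero => simp [adams_zero, counit_of_mem_primitives hx]
  | succ m ih =>
    rw [adams_add, convMul_of_mem_primitives _ _ hx]
    simp only [AlgHom.toLinearMap_apply, map_one, ih, adams_one]
    push_cast
    ring

/-- The Adams operations of a conilpotent Hopf algebra are polynomial in the exponent. -/
lemma exists_adamsPolynomial [CharZero k] (hA : IsConilpotent k A) (a : A) :
    ∃ P : A[X], ∀ m : ℕ, P.eval (m : A) = adams k A m a := by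
  -- The interpolation is the binomial series of (1 + J)^m, with binomial coefficients read as
  -- polynomials in m. It terminates at `a` because `J` kills 1.
  let J : WithConv (A →ₗ[k] A) := toConv LinearMap.id - 1
  have hJ1 : J.ofConv 1 = 0 := by
    change (1 : A) - (1 : WithConv (A →ₗ[k] A)).ofConv 1 = 0
    simp
  obtain ⟨N, hN⟩ := hA a
  refine ⟨∑ n ∈ Finset.range N,
    C ((n.factorial : k)⁻¹ • (J ^ n).ofConv a) * descPochhammer A n, fun m => ?_⟩
  have hterm : ∀ n, eval (m : A) (C ((n.factorial : k)⁻¹ • (J ^ n).ofConv a) *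
      descPochhammer A n) = (m.choose n : A) * (J ^ n).ofConv a := by
    intro n
    have hne : (n.factorial : k) ≠ 0 := by exact_mod_cast n.factorial_ne_zero
    rw [eval_mul, eval_C, descPochhammer_eval_eq_descFactorial,
      Nat.descFactorial_eq_factorial_mul_choose, Nat.cast_mul, smul_mul_assoc, inv_smul_eq_iff₀ hne,
      ← map_natCast (algebraMap k A) n.factorial, ← Algebra.smul_def]
    simp only [Algebra.smul_def]
    ring
  have hid : (toConv LinearMap.id : WithConv (A →ₗ[k] A)) = J + 1 := by simp [J]
  rw [eval_finsetSum, adams_apply, hid, (Commute.one_right J).add_pow]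
  have happ : ∀ (s : Finset ℕ) (g : ℕ → WithConv (A →ₗ[k] A)),
      (∑ i ∈ s, g i).ofConv a = ∑ i ∈ s, (g i).ofConv a := by
    intro s g
    have := map_sum ((LinearMap.applyₗ a).comp (WithConv.linearEquiv k (A →ₗ[k] A)).toLinearMap) g s
    exact this
  rw [happ]
  have hterm' : ∀ n, (J ^ n * 1 ^ (m - n) * ((m.choose n : ℕ) : WithConv (A →ₗ[k] A))).ofConv a =
      (m.choose n : A) * (J ^ n).ofConv a := by
    intro n
    rw [one_pow, mul_one, ← nsmul_eq_mul', ← nsmul_eq_mul]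
    exact map_nsmul ((LinearMap.applyₗ a).comp (WithConv.linearEquiv k (A →ₗ[k] A)).toLinearMap) _ _
  simp only [hterm, hterm']
  -- Both sums extend to a common range: terms from `N` on vanish by nilpotence, terms beyond `m` by
  -- the binomial coefficient.
  rw [Finset.sum_subset (Finset.range_mono (le_max_left N (m + 1))),
    Finset.sum_subset (Finset.range_mono (le_max_right N (m + 1)))]
  · intro n _ hn
    rw [Nat.choose_eq_zero_of_lt (by simpa using hn)]
    simp
  · intro n _ hn
    rw [convPow_eq_zero J hJ1 (by simpa using hn) hN, mul_zero]

/-- The polynomial interpolating the values of the Adams operations at `a`. -/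
noncomputable def adamsPolynomial [CharZero k] (hA : IsConilpotent k A) : A →ₗ[k] A[X] where
  toFun a := (exists_adamsPolynomial hA a).choose
  map_add' a b := polynomial_ext_of_eval_nat (k := k) fun m => by
    rw [eval_add, (exists_adamsPolynomial hA a).choose_spec,
      (exists_adamsPolynomial hA b).choose_spec, (exists_adamsPolynomial hA (a + b)).choose_spec,
      map_add]
  map_smul' c a := polynomial_ext_of_eval_nat (k := k) fun m => by
    rw [RingHom.id_apply, eval_smul, (exists_adamsPolynomial hA a).choose_spec,
      (exists_adamsPolynomial hA (c • a)).choose_spec, map_smul]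

variable [CharZero k] (hA : IsConilpotent k A) (hB : IsConilpotent k B)

lemma eval_adamsPolynomial (a : A) (m : ℕ) :
    (adamsPolynomial hA a).eval (m : A) = adams k A m a :=
  (exists_adamsPolynomial hA a).choose_spec m

lemma adamsPolynomial_mul (a b : A) :
    adamsPolynomial hA (a * b) = adamsPolynomial hA a * adamsPolynomial hA b :=
  polynomial_ext_of_eval_nat (k := k) fun m => by
    rw [eval_mul, eval_adamsPolynomial, eval_adamsPolynomial, eval_adamsPolynomial, map_mul]

lemma adamsPolynomial_coeff_zero (a : A) :
    (adamsPolynomial hA a).coeff 0 = algebraMap k A (counit a) := by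
  rw [coeff_zero_eq_eval_zero, ← Nat.cast_zero, eval_adamsPolynomial, adams_zero]

lemma adamsPolynomial_bialgHom (f : B →ₐc[k] A) (b : B) :
    adamsPolynomial hA (f b) = (adamsPolynomial hB b).map (f : B →+* A) :=
  polynomial_ext_of_eval_nat (k := k) fun m => by
    have := eval_map_apply (f : B →+* A) (p := adamsPolynomial hB b) (m : B)
    rw [map_natCast] at this
    rw [this, eval_adamsPolynomial, eval_adamsPolynomial, adams_bialgHom]
    rfl

lemma adamsPolynomial_of_mem_primitives {x : A} (hx : x ∈ primitives k A) :
    adamsPolynomial hA x = C x * X :=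
  polynomial_ext_of_eval_nat (k := k) fun m => by
    rw [eval_adamsPolynomial, adams_of_mem_primitives hx, eval_mul, eval_C, eval_X, mul_comm]

/-- The first Eulerian idempotent, i.e. the convolution logarithm of the identity. -/
noncomputable def eulerian : A →ₗ[k] A :=
  ((lcoeff A 1).restrictScalars k) ∘ₗ adamsPolynomial hA

lemma eulerian_apply (a : A) : eulerian hA a = (adamsPolynomial hA a).coeff 1 := rfl

/-- The Adams polynomial is multiplicative with constant term the counit, so its linear coefficient
obeys a Leibniz rule. Composing with any linear functional thus gives a tangent vector. -/
lemma eulerian_mul (a b : A) : eulerian hA (a * b) =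
    counit (R := k) a • eulerian hA b + counit (R := k) b • eulerian hA a := by
  rw [eulerian_apply, adamsPolynomial_mul, mul_coeff_one, adamsPolynomial_coeff_zero,
    adamsPolynomial_coeff_zero, Algebra.smul_def, Algebra.smul_def, mul_comm (coeff _ 1)]
  rfl

lemma eulerian_bialgHom (f : B →ₐc[k] A) (b : B) : eulerian hA (f b) = f (eulerian hB b) := by
  rw [eulerian_apply, adamsPolynomial_bialgHom hA hB, coeff_map]
  rfl

lemma eulerian_of_mem_primitives {x : A} (hx : x ∈ primitives k A) : eulerian hA x = x := by
  rw [eulerian_apply, adamsPolynomial_of_mem_primitives hA hx]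
  simp

/-- The coefficients of the Adams polynomial are the divided convolution powers of the Eulerian
idempotent. -/
lemma adamsPolynomial_coeff (n : ℕ) (a : A) : (adamsPolynomial hA a).coeff n =
    (n.factorial : k)⁻¹ • ((toConv (eulerian hA)) ^ n).ofConv a := by
  -- Differentiating the power law for exponent m + t at t = 0 shows that the derivative of the
  -- Adams polynomial is its convolution with the Eulerian idempotent. Comparing coefficients then
  -- gives the exponential series.
  have h1 : ∀ (m : ℕ) (a : A), (derivative (adamsPolynomial hA a)).eval (m : A) =
      (toConv (adams k A m).toLinearMap * toConv (eulerian hA)).ofConv a := by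
    intro m a
    let r := ℛ k a
    have hcomp : (adamsPolynomial hA a).comp (X + C (m : A)) =
        ∑ i ∈ r.index, C (adams k A m (r.left i)) * adamsPolynomial hA (r.right i) := by
      apply polynomial_ext_of_eval_nat (k := k)
      intro t
      rw [eval_comp, eval_add, eval_X, eval_C, ← Nat.cast_add, eval_adamsPolynomial, add_comm,
        adams_add, r.convMul_apply, eval_finsetSum]
      refine Finset.sum_congr rfl fun i _ => ?_
      rw [eval_mul, eval_C, eval_adamsPolynomial]
      rfl
    have := congrArg (fun p => (derivative p).eval 0) hcomp
    simp only [derivative_comp, eval_mul, eval_comp, derivative_sum, eval_finsetSum] at this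
    rw [r.convMul_apply]
    simpa [← coeff_zero_eq_eval_zero, coeff_derivative, eulerian_apply] using this
  have h2 : ∀ a : A, derivative (adamsPolynomial hA a) = ∑ i ∈ (ℛ k a).index,
      adamsPolynomial hA ((ℛ k a).left i) * C (eulerian hA ((ℛ k a).right i)) := by
    intro a
    apply polynomial_ext_of_eval_nat (k := k)
    intro m
    rw [h1, (ℛ k a).convMul_apply, eval_finsetSum]
    refine Finset.sum_congr rfl fun i _ => ?_
    rw [eval_mul, eval_C, eval_adamsPolynomial]
    rfl
  induction n generalizing a with
  | zero => simp [adamsPolynomial_coeff_zero]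
  | succ n ih =>
    have h3 := congrArg (fun p => p.coeff n) (h2 a)
    simp only [coeff_derivative, finsetSum_coeff, coeff_mul_C, ih, smul_mul_assoc,
      ← Finset.smul_sum] at h3
    have h4 := (ℛ k a).convMul_apply ((toConv (eulerian hA)) ^ n) (toConv (eulerian hA))
    rw [← pow_succ] at h4
    rw [h4]
    have hne : ((n + 1 : ℕ) : k) ≠ 0 := by exact_mod_cast n.succ_ne_zero
    rw [Nat.factorial_succ, Nat.cast_mul, mul_inv, mul_smul, eq_inv_smul_iff₀ hne]
    rw [← h3, Algebra.smul_def, map_natCast]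
    push_cast
    ring

end Adams

/-! ### Exponentials of tangent vectors and lifting in characteristic 0. -/

section Exponential

variable {k A B : Type*} [Field k] [CommRing A] [HopfAlgebra k A] [CommRing B] [HopfAlgebra k B]

variable (k A) in
/-- Tangent vectors at the identity: functionals that satisfy the Leibniz rule relative to the
counit. -/
def IsTangent (δ : Module.Dual k A) : Prop :=
  ∀ a b : A, δ (a * b) = counit (R := k) a * δ b + counit (R := k) b * δ a

lemma IsTangent.map_one {δ : Module.Dual k A} (hδ : IsTangent k A δ) : δ 1 = 0 := by
  have := hδ 1 1
  rwa [mul_one, Bialgebra.counit_one, one_mul, left_eq_add] at this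

lemma apply_rightTranslate (φ η : Module.Dual k A) (a : A) :
    φ (rightTranslate η a) = (toConv φ * toConv η).ofConv a := by
  rw [LinearMap.convMul_apply, rightTranslate_apply]
  induction comul (R := k) a with
  | zero => simp
  | add s t hs ht => simp only [map_add, hs, ht]
  | tmul x y => simp [mul_comm]

/-- Replaces convolution powers of `δ` by iterates of one operator, which is a derivation when `δ`
is a tangent vector. -/
lemma convPow_apply_eq_counit (δ : Module.Dual k A) (n : ℕ) (a : A) :
    (toConv δ ^ n).ofConv a = counit (R := k) ((rightTranslate δ ^ n) a) := by
  induction n generalizing a with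
  | zero => simp
  | succ n ih =>
    rw [pow_succ, pow_succ, Module.End.mul_apply, ← ih]
    exact (apply_rightTranslate _ δ a).symm

lemma IsTangent.rightTranslate_mul {δ : Module.Dual k A} (hδ : IsTangent k A δ) (a b : A) :
    rightTranslate δ (a * b) = a * rightTranslate δ b + b * rightTranslate δ a := by
  have h : ∀ s t : A ⊗[k] A, rightSlice A δ (s * t) =
      rightSlice A (counit (R := k)) s * rightSlice A δ t +
        rightSlice A (counit (R := k)) t * rightSlice A δ s := by
    intro s t
    induction s with
    | zero => simp
    | add s s' hs hs' => simp only [add_mul, map_add, mul_add, hs, hs']; ring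
    | tmul x y =>
      induction t with
      | zero => simp
      | add t t' ht ht' => simp only [add_mul, map_add, mul_add, ht, ht']; ring
      | tmul z w =>
        simp only [Algebra.TensorProduct.tmul_mul_tmul, rightSlice_tmul, hδ y w,
          Algebra.smul_def, map_mul, map_add]
        ring
  have hε : ∀ a : A, rightSlice A (counit (R := k)) (comul a) = a := by
    intro a
    simp [rightSlice]
  rw [rightTranslate_apply, Bialgebra.comul_mul, h, hε, hε]
  rfl

/-- The Leibniz rule for divided convolution powers of a tangent vector. -/
lemma IsTangent.dividedPow_mul [CharZero k] {δ : Module.Dual k A} (hδ : IsTangent k A δ) (n : ℕ)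
    (a b : A) : (n.factorial : k)⁻¹ * (toConv δ ^ n).ofConv (a * b) =
      ∑ p ∈ Finset.HasAntidiagonal.antidiagonal n,
        ((p.1.factorial : k)⁻¹ * (toConv δ ^ p.1).ofConv a) *
        ((p.2.factorial : k)⁻¹ * (toConv δ ^ p.2).ofConv b) := by
  set D := rightTranslate δ with hD
  -- A derivation passes through multiplication as D ⊗ 1 + 1 ⊗ D. The two summands commute, so the
  -- binomial theorem applies to the powers.
  have h1 : ∀ n, (D ^ n) ∘ₗ LinearMap.mul' k A =
      LinearMap.mul' k A ∘ₗ (D.rTensor A + D.lTensor A) ^ n := by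
    intro n
    induction n with
    | zero => rfl
    | succ n ih =>
      have hone : D ∘ₗ LinearMap.mul' k A = LinearMap.mul' k A ∘ₗ (D.rTensor A + D.lTensor A) := by
        ext a b
        simp [hD, hδ.rightTranslate_mul a b, add_comm, mul_comm]
      rw [pow_succ, pow_succ', Module.End.mul_eq_comp, LinearMap.comp_assoc, hone,
        ← LinearMap.comp_assoc, ih, LinearMap.comp_assoc, ← Module.End.mul_eq_comp, ← pow_succ,
        ← pow_succ']
  have hcomm : Commute (D.rTensor A) (D.lTensor A) := by
    change D.rTensor A ∘ₗ D.lTensor A = D.lTensor A ∘ₗ D.rTensor A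
    rw [LinearMap.rTensor_comp_lTensor, LinearMap.lTensor_comp_rTensor]
  have h2 := LinearMap.congr_fun (h1 n) (a ⊗ₜ b)
  rw [hcomm.add_pow'] at h2
  simp only [LinearMap.comp_apply, LinearMap.mul'_apply, LinearMap.sum_apply, map_sum,
    LinearMap.smul_apply, LinearMap.rTensor_pow, LinearMap.lTensor_pow, Module.End.mul_apply,
    LinearMap.lTensor_tmul, LinearMap.rTensor_tmul, map_nsmul] at h2
  rw [convPow_apply_eq_counit, ← hD, h2, map_sum, Finset.mul_sum]
  refine Finset.sum_congr rfl fun p hp => ?_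
  obtain rfl := Finset.HasAntidiagonal.mem_antidiagonal.mp hp
  rw [convPow_apply_eq_counit, convPow_apply_eq_counit, ← hD, map_nsmul, Bialgebra.counit_mul,
    Nat.choose_symm_add, Nat.add_choose, nsmul_eq_mul,
    Nat.cast_div (Nat.factorial_mul_factorial_dvd_factorial_add _ _)]
  · push_cast
    have h3 : ((p.1 + p.2).factorial : k) ≠ 0 := by exact_mod_cast Nat.factorial_ne_zero _
    have h4 : (p.1.factorial : k) ≠ 0 := by exact_mod_cast Nat.factorial_ne_zero _
    have h5 : (p.2.factorial : k) ≠ 0 := by exact_mod_cast Nat.factorial_ne_zero _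
    field_simp
  · exact_mod_cast mul_ne_zero (Nat.factorial_ne_zero _) (Nat.factorial_ne_zero _)

/-- The exponential of a tangent vector as a rational point, together with the one-parameter
subgroup it lies on. -/
lemma IsTangent.exists_exp [CharZero k] (hA : IsConilpotent k A) {δ : Module.Dual k A}
    (hδ : IsTangent k A δ) : ∃ (P : A →ₗ[k] k[X]) (g : A →ₐ[k] k),
      (∀ a n, (P a).coeff n = (n.factorial : k)⁻¹ * (toConv δ ^ n).ofConv a) ∧
      ∀ a, g a = (P a).eval 1 := by
  obtain ⟨P, hP⟩ := exists_polynomial_coeff (R := k)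
    (fun n => (n.factorial : k)⁻¹ • (toConv δ ^ n).ofConv) (fun a => by
      obtain ⟨N, hN⟩ := hA a
      refine ⟨N, fun n hn => ?_⟩
      rw [LinearMap.smul_apply, convPow_eq_zero _ hδ.map_one hn hN, smul_zero])
  have hP' : ∀ a n, (P a).coeff n = (n.factorial : k)⁻¹ * (toConv δ ^ n).ofConv a := hP
  refine ⟨P, AlgHom.ofLinearMap ((leval (1 : k)) ∘ₗ P) ?_ ?_, hP', fun a => rfl⟩
  · have : P 1 = 1 := by
      ext n
      rw [hP', coeff_one]
      rcases n with _ | n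
      · simp
      · rw [convPow_eq_zero _ hδ.map_one (Nat.le_add_left 1 n) (one_mem_loewy 0), mul_zero]
        simp
    rw [LinearMap.comp_apply, this]
    simp [leval_apply]
  · intro a b
    have : P (a * b) = P a * P b := by
      ext n
      rw [hP', coeff_mul, hδ.dividedPow_mul]
      simp only [hP']
    simp [leval_apply, this]

/-- In characteristic zero a rational point of a quotient lifts to a rational point with prescribed
compatible values on the additive characters. -/
lemma exists_lift_of_charZero [CharZero k] (hA : IsConilpotent k A) (hB : IsConilpotent k B)
    (f : B →ₐc[k] A) (hf : Function.Injective f) (h : B →ₐ[k] k)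
    (l : Module.Dual k (primitives k A))
    (hl : ∀ (b : B) (x : primitives k A), f b = x → h b = l x) :
    ∃ g : A →ₐ[k] k, g.comp (f : B →ₐ[k] A) = h ∧ ∀ x : primitives k A, g x = l x := by
  -- Only a linear extension is needed: the Eulerian idempotent turns `ℓ` into a tangent vector. It
  -- is natural in the Hopf algebra and fixes primitives, so it retains the prescribed data.
  obtain ⟨ℓ, hℓf, hℓl⟩ := exists_dual_extension (i := (f : B →ₗ[k] A)) hf (primitives k A)
    h.toLinearMap l hl
  have hδ : IsTangent k A (ℓ ∘ₗ eulerian hA) := fun a b => by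
    simp [eulerian_mul]
  obtain ⟨P, g, hP, hg⟩ := hδ.exists_exp hA
  refine ⟨g, ?_, fun x => ?_⟩
  · ext b
    have hδf : (ℓ ∘ₗ eulerian hA) ∘ₗ (f : B →ₗ[k] A) = h.toLinearMap ∘ₗ eulerian hB := by
      ext b
      have := LinearMap.congr_fun hℓf (eulerian hB b)
      simpa [eulerian_bialgHom hA hB] using this
    -- On `B` the exponential series is `h` applied to the Adams polynomial, whose value at 1 is `b`
    -- itself.
    have hPf : P (f b) = (adamsPolynomial hB b).map (h : B →+* k) := by
      ext n
      rw [hP, coeff_map, adamsPolynomial_coeff, convPow_bialgHom]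
      have := algHom_convPow h (toConv (eulerian hB)) n b
      rw [RingHom.coe_coe, map_smul, this, smul_eq_mul]
      congr 5
    change g (f b) = h b
    have := eval_map_apply (h : B →+* k) (p := adamsPolynomial hB b) ((1 : ℕ) : B)
    rw [eval_adamsPolynomial, adams_one, map_natCast, Nat.cast_one] at this
    rw [hg, hPf, this]
    rfl
  -- On a primitive element the convolution powers from the second on vanish, since the tangent
  -- vector kills 1.
  · have hPx : P (x : A) = C (l x) * X := by
      ext n
      rw [hP, coeff_C_mul_X]
      rcases n with _ | _ | n
      · simp [counit_of_mem_primitives x.2]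
      · have := LinearMap.congr_fun hℓl x
        simpa [eulerian_of_mem_primitives hA x.2] using this
      · rw [pow_succ, convMul_of_mem_primitives _ _ x.2,
          convPow_eq_zero (toConv (ℓ ∘ₗ eulerian hA)) hδ.map_one (Nat.le_add_left 1 n)
            (one_mem_loewy 0)]
        have := hδ.map_one
        simp only [LinearMap.comp_apply] at this
        simp [this]
    rw [hg, hPx]
    simp

end Exponential

/-! ### Algebras over 𝔽_p on which Frobenius is the identity. -/

section FrobeniusFixed

variable {k A B : Type*} [Field k] [CommRing A] [CommRing B] [Algebra k A] [Algebra k B] {p : ℕ}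

lemma natCast_surjective_of_card_prime (hp : p.Prime) (hk : Nat.card k = p) :
    Function.Surjective (Nat.cast : ℕ → k) := by
  have : Fact p.Prime := ⟨hp⟩
  have hfin : Finite k := Nat.finite_of_card_ne_zero (hk ▸ hp.ne_zero)
  have := Fintype.ofFinite k
  have hchar : CharP k p := by
    obtain ⟨q, hq⟩ := CharP.exists k
    have hqp : q.Prime := CharP.char_is_prime k q
    obtain ⟨n, -, hn⟩ := FiniteField.card k q
    rw [← Nat.card_eq_fintype_card, hk] at hn
    have hqp' : q = p := (Nat.prime_dvd_prime_iff_eq hqp hp).mp (hn ▸ dvd_pow_self q n.ne_zero)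
    exact hqp' ▸ hq
  have hb : Function.Bijective (ZMod.castHom (dvd_refl p) k) := by
    rw [Fintype.bijective_iff_injective_and_card]
    refine ⟨RingHom.injective _, ?_⟩
    rw [ZMod.card, ← Nat.card_eq_fintype_card, hk]
  intro c
  obtain ⟨z, rfl⟩ := hb.2 c
  refine ⟨z.val, ?_⟩
  conv_rhs => rw [← ZMod.natCast_zmod_val z]
  rw [map_natCast]

lemma pow_card_prime (hp : p.Prime) (hk : Nat.card k = p) (c : k) : c ^ p = c := by
  have hfin : Finite k := Nat.finite_of_card_ne_zero (hk ▸ hp.ne_zero)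
  have := Fintype.ofFinite k
  rw [← hk, Nat.card_eq_fintype_card, FiniteField.pow_card]

/-- A domain over `𝔽_p` all of whose elements are fixed by the Frobenius is `𝔽_p`. -/
lemma algebraMap_surjective_of_pow_eq [IsDomain A] (hp : p.Prime) (hk : Nat.card k = p)
    (hA : ∀ a : A, a ^ p = a) : Function.Surjective (algebraMap k A) := by
  intro a
  have hfin : Finite k := Nat.finite_of_card_ne_zero (hk ▸ hp.ne_zero)
  have := Fintype.ofFinite k
  have hprod : (Polynomial.X ^ p - Polynomial.X : Polynomial k) =
      ∏ c : k, (Polynomial.X - Polynomial.C c) := by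
    rw [← hk, Nat.card_eq_fintype_card]
    have hlt : 1 < Fintype.card k := Fintype.one_lt_card
    have hroots := FiniteField.roots_X_pow_card_sub_X k
    rw [← Polynomial.prod_multiset_X_sub_C_of_monic_of_roots_card_eq
      (Polynomial.monic_X_pow_sub (by rw [Polynomial.degree_X]; exact_mod_cast hlt))
      (by rw [hroots, FiniteField.X_pow_card_sub_X_natDegree_eq k hlt]; rfl), hroots]
    rfl
  have := congrArg (Polynomial.aeval a) hprod
  rw [map_sub, map_pow, Polynomial.aeval_X, hA, sub_self, map_prod, eq_comm,
    Finset.prod_eq_zero_iff] at this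
  obtain ⟨c, -, hc⟩ := this
  refine ⟨c, ?_⟩
  rw [map_sub, Polynomial.aeval_X, Polynomial.aeval_C, sub_eq_zero] at hc
  exact hc.symm

/-- Each prime ideal is the kernel of a rational point when all elements are fixed by the
Frobenius. -/
lemma exists_algHom_ker_eq (hp : p.Prime) (hk : Nat.card k = p) (hA : ∀ a : A, a ^ p = a)
    (P : Ideal A) [P.IsPrime] : ∃ g : A →ₐ[k] k, RingHom.ker g = P := by
  have hs : Function.Surjective (algebraMap k (A ⧸ P)) :=
    algebraMap_surjective_of_pow_eq hp hk fun a => by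
      obtain ⟨a, rfl⟩ := Ideal.Quotient.mk_surjective a
      rw [← map_pow, hA]
  let E := AlgEquiv.ofBijective (Algebra.ofId k (A ⧸ P)) ⟨(algebraMap k (A ⧸ P)).injective, hs⟩
  refine ⟨(E.symm : (A ⧸ P) →ₐ[k] k).comp (Ideal.Quotient.mkₐ k P), ?_⟩
  ext a
  rw [RingHom.mem_ker]
  change E.symm (Ideal.Quotient.mk P a) = 0 ↔ a ∈ P
  rw [map_eq_zero_iff _ E.symm.injective, Ideal.Quotient.eq_zero_iff_mem]

lemma algHom_eq_of_ker_le {g h : A →ₐ[k] k} (hgh : ∀ a, g a = 0 → h a = 0) : g = h := by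
  ext a
  have := hgh (a - algebraMap k A (g a)) (by simp)
  rw [map_sub, AlgHom.commutes, sub_eq_zero] at this
  exact this.symm

lemma mul_pow_pred_of_pow_eq (hp : p.Prime) (hA : ∀ a : A, a ^ p = a) (a : A) :
    a * a ^ (p - 1) = a := by
  rw [← pow_succ', Nat.sub_add_cancel hp.one_le, hA]

/-- Rational points of a subalgebra lift when all elements are fixed by the Frobenius. -/
lemma exists_comp_eq_of_pow_eq (hp : p.Prime) (hk : Nat.card k = p) (hA : ∀ a : A, a ^ p = a)
    (f : B →ₐ[k] A) (hf : Function.Injective f) (h : B →ₐ[k] k) :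
    ∃ g : A →ₐ[k] k, g.comp f = h := by
  have hB : ∀ b : B, b ^ p = b := fun b => hf (by rw [map_pow, hA])
  have hprime : (RingHom.ker h).IsPrime := RingHom.ker_isPrime h
  -- The relation b(1 − b^(p−1)) = 0 makes every prime of `B` minimal, and minimal primes are
  -- contracted from any ring into which `B` injects.
  have hmin : RingHom.ker h ∈ minimalPrimes B := by
    rw [minimalPrimes_eq_minimals]
    refine ⟨hprime, fun Q hQ hle b hb => ?_⟩
    have hmul : b * (1 - b ^ (p - 1)) = 0 := by
      rw [mul_sub, mul_one, mul_pow_pred_of_pow_eq hp hB, sub_self]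
    rcases hQ.mem_or_mem (hmul ▸ Q.zero_mem) with h1 | h1
    · exact h1
    · exfalso
      have h2 := hle h1
      rw [RingHom.mem_ker] at h2 hb
      rw [map_sub, map_one, map_pow, hb, zero_pow (Nat.sub_ne_zero_of_lt hp.one_lt), sub_zero] at h2
      exact one_ne_zero h2
  obtain ⟨P, hP, hPf⟩ := Ideal.exists_comap_eq_of_mem_minimalPrimes_of_injective
    (f := (f : B →+* A)) hf _ hmin
  obtain ⟨g, hg⟩ := exists_algHom_ker_eq hp hk hA P
  refine ⟨g, (algHom_eq_of_ker_le fun b hb => ?_).symm⟩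
  have : b ∈ P.comap (f : B →+* A) := hPf ▸ hb
  rw [← hg] at this
  exact this

/-- An element of an ideal generated by Frobenius-fixed elements of a subalgebra is fixed by
multiplication with an element from the same ideal of the subalgebra. -/
lemma exists_mul_eq_of_mem_map (hp : p.Prime) (hA : ∀ a : A, a ^ p = a) (f : B →+* A)
    (I : Ideal B) {x : A} (hx : x ∈ I.map f) : ∃ u ∈ I, f u * x = x := by
  induction hx using Submodule.span_induction with
  | mem x hx =>
    obtain ⟨b, hb, rfl⟩ := hx
    refine ⟨b ^ (p - 1), I.pow_mem_of_mem hb _ (Nat.sub_pos_of_lt hp.one_lt), ?_⟩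
    rw [map_pow, mul_comm, mul_pow_pred_of_pow_eq hp hA]
  | zero => exact ⟨0, I.zero_mem, by simp⟩
  | add x y _ _ hx hy =>
    obtain ⟨u, hu, hux⟩ := hx
    obtain ⟨v, hv, hvy⟩ := hy
    -- Here 1 − (u + v − uv) = (1 − u)(1 − v) annihilates both summands.
    refine ⟨u + v - u * v, sub_mem (add_mem hu hv) (I.mul_mem_left _ hv), ?_⟩
    rw [map_sub, map_add, map_mul]
    linear_combination (1 - f v) * hux + (1 - f u) * hvy
  | smul a x _ hx =>
    obtain ⟨u, hu, hux⟩ := hx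
    refine ⟨u, hu, ?_⟩
    rw [smul_eq_mul]
    linear_combination a * hux

/-- An element on which all rational points over the same point of a subalgebra agree lies in the
subalgebra. -/
lemma mem_range_of_forall_comp_eq (hp : p.Prime) (hk : Nat.card k = p) (hA : ∀ a : A, a ^ p = a)
    (f : B →ₐ[k] A) (hf : Function.Injective f) {x : A}
    (hx : ∀ g g' : A →ₐ[k] k, g.comp f = g'.comp f → g x = g' x) : ∃ b, f b = x := by
  have hB : ∀ b : B, b ^ p = b := fun b => hf (by rw [map_pow, hA])
  -- The conductor of `x` into `B`. If it lay in a maximal ideal m, then `x` would be constant on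
  -- the points over m, and this forces an element of the conductor outside m.
  let I : Ideal B :=
    { carrier := {b | ∃ c, f c = f b * x}
      add_mem' := by
        rintro b b' ⟨c, hc⟩ ⟨c', hc'⟩
        exact ⟨c + c', by rw [map_add, hc, hc', map_add, add_mul]⟩
      zero_mem' := ⟨0, by simp⟩
      smul_mem' := by
        rintro b b' ⟨c, hc⟩
        exact ⟨b * c, by rw [map_mul, hc, smul_eq_mul, map_mul, mul_assoc]⟩ }
  suffices h : (1 : B) ∈ I by
    obtain ⟨c, hc⟩ := h
    exact ⟨c, by rw [hc, map_one, one_mul]⟩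
  rw [← Ideal.eq_top_iff_one]
  by_contra hI
  obtain ⟨m, hm, hIm⟩ := Ideal.exists_le_maximal I hI
  have := hm.isPrime
  obtain ⟨h, hh⟩ := exists_algHom_ker_eq (k := k) hp hk hB m
  obtain ⟨g, hg⟩ := exists_comp_eq_of_pow_eq hp hk hA f hf h
  have hmem : x - algebraMap k A (g x) ∈ m.map (f : B →+* A) := by
    -- Every `y` equals its p^n-th power and p^n > n, so `y` is a multiple of y^n.
    have hrad : (m.map (f : B →+* A)).IsRadical := by
      intro y hy
      obtain ⟨n, hn⟩ := hy
      have hyn : ∀ n, y ^ (p ^ n) = y := by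
        intro n
        induction n with
        | zero => simp
        | succ n ih => rw [pow_succ, pow_mul, ih, hA]
      rw [← hyn n, ← Nat.sub_add_cancel (Nat.lt_pow_self hp.one_lt (n := n)).le, pow_add]
      exact Ideal.mul_mem_left _ _ hn
    rw [← hrad.radical, Ideal.radical_eq_sInf, Submodule.mem_sInf]
    rintro P ⟨hmP, hP⟩
    obtain ⟨g', hg'⟩ := exists_algHom_ker_eq (k := k) hp hk hA P
    have hcomp : g'.comp f = h := by
      refine (algHom_eq_of_ker_le fun b hb => ?_).symm
      have hbm : b ∈ m := hh ▸ hb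
      have : f b ∈ P := hmP (Ideal.mem_map_of_mem (f : B →+* A) hbm)
      rw [← hg'] at this
      exact this
    rw [← hg', RingHom.mem_ker, map_sub, AlgHom.commutes, hx g' g (hcomp.trans hg.symm)]
    exact sub_self _
  obtain ⟨u, hu, hux⟩ := exists_mul_eq_of_mem_map hp hA (f : B →+* A) m hmem
  have h1u : 1 - u ∈ I := by
    refine ⟨(1 - u) * algebraMap k B (g x), ?_⟩
    rw [map_mul, AlgHom.commutes, map_sub, map_one]
    have hux' : f u * (x - algebraMap k A (g x)) = x - algebraMap k A (g x) := hux
    linear_combination hux'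
  apply hm.ne_top
  rw [Ideal.eq_top_iff_one]
  have := add_mem (hIm h1u) hu
  rwa [sub_add_cancel] at this

end FrobeniusFixed

/-! ### Lifting over a prime field. -/

section PrimeField

variable {k A B : Type u} [Field k] [CommRing A] [HopfAlgebra k A] [CommRing B] [HopfAlgebra k B]
  {p : ℕ}

/-- Each finite stage is an algebra of 𝔽_p-valued functions, where Frobenius acts trivially. -/
lemma IsProunipotent.pow_eq (h : IsProunipotent k A) (hp : p.Prime) (hk : Nat.card k = p) (a : A) :
    a ^ p = a := by
  obtain ⟨D⟩ := h
  obtain ⟨i, x, rfl⟩ := D.exhaustive a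
  let _ := D.commRing i
  let _ := D.hopfAlgebra i
  obtain ⟨Γ, _, _, θ, -, hθ⟩ := (D.unipotent i).constant p hp hk
  have : x ^ p = x := hθ.1 (funext fun γ => by
    change (θ γ).ofConv (x ^ p) = (θ γ).ofConv x
    rw [map_pow, pow_card_prime hp hk])
  rw [← map_pow, this]

/-- Over a prime field a rational point of a quotient lifts to a rational point with prescribed
compatible values on the additive characters. -/
lemma exists_lift_of_card_prime (hp : p.Prime) (hk : Nat.card k = p) (hA : ∀ a : A, a ^ p = a)
    [Module.Finite k (primitives k A)]
    (f : B →ₐc[k] A) (hf : Function.Injective f) (h : B →ₐ[k] k)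
    (l : Module.Dual k (primitives k A))
    (hl : ∀ (b : B) (x : primitives k A), f b = x → h b = l x) :
    ∃ g : A →ₐ[k] k, g.comp (f : B →ₐ[k] A) = h ∧ ∀ x : primitives k A, g x = l x := by
  obtain ⟨g₀, hg₀⟩ := exists_comp_eq_of_pow_eq hp hk hA (f : B →ₐ[k] A) hf h
  have hmul : ∀ (g g' : Points k A) (x : primitives k A),
      (g * g').ofConv (x : A) = g.ofConv (x : A) + g'.ofConv (x : A) := by
    intro g g' x
    rw [AlgHom.convMul_apply, mem_primitives.mp x.2]
    simp
  have hone : ∀ x : primitives k A, (1 : Points k A).ofConv (x : A) = 0 := by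
    intro x
    simp [counit_of_mem_primitives x.2]
  have hcompmul : ∀ (g g' : Points k A),
      mapPoints f (g * g') = mapPoints f g * mapPoints f g' := fun g g' =>
    WithConv.ext (AlgHom.convMul_comp_bialgHom_distrib g g' f)
  have hcompone : mapPoints f (1 : Points k A) = 1 := by
    ext b
    exact (AlgHom.convOne_apply _).trans
      (congrArg (algebraMap k k) (CoalgHomClass.counit_comp_apply f b))
  let ev : Points k A → Module.Dual k (primitives k A) := fun g =>
    g.ofConv.toLinearMap ∘ₗ (primitives k A).subtype
  have hev : ∀ g x, ev g x = g.ofConv (x : A) := fun _ _ => rfl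
  let W₀ : AddSubmonoid (Module.Dual k (primitives k A)) :=
    { carrier := {w | ∃ n : Points k A, mapPoints f n = 1 ∧ ev n = w}
      zero_mem' := ⟨1, hcompone, LinearMap.ext hone⟩
      add_mem' := by
        rintro _ _ ⟨n, hn, rfl⟩ ⟨n', hn', rfl⟩
        exact ⟨n * n', by rw [hcompmul, hn, hn', one_mul], LinearMap.ext (hmul n n')⟩ }
  -- The values on characters of the points of ker f are closed under addition, and every scalar of
  -- 𝔽_p is a natural number, so they form a subspace.
  let W : Submodule k (Module.Dual k (primitives k A)) :=
    { W₀ with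
      smul_mem' := by
        intro c w hw
        obtain ⟨m, rfl⟩ := natCast_surjective_of_card_prime hp hk c
        rw [Nat.cast_smul_eq_nsmul]
        exact W₀.nsmul_mem hw m }
  -- By finite-dimensional duality it suffices to test on characters `x` killed by `W`. Such an `x`
  -- takes equal values at points with the same image in H, hence lies in `B`, where `l` agrees with
  -- `h` by compatibility.
  have hν : l - ev (toConv g₀) ∈ W := by
    rw [← Subspace.dualCoannihilator_dualAnnihilator_eq (W := W), Submodule.mem_dualAnnihilator]
    intro x hx
    rw [Submodule.mem_dualCoannihilator] at hx
    obtain ⟨b, hb⟩ : ∃ b, (f : B →ₐ[k] A) b = x := by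
      refine mem_range_of_forall_comp_eq hp hk hA (f : B →ₐ[k] A) hf fun g g' hgg' => ?_
      have hgg : mapPoints f (toConv g) = mapPoints f (toConv g') :=
        WithConv.ext hgg'
      have hn : mapPoints f ((toConv g)⁻¹ * toConv g' : Points k A) = 1 := by
        rw [hcompmul, ← hgg, ← hcompmul, inv_mul_cancel, hcompone]
      have h0 := hx (ev ((toConv g)⁻¹ * toConv g')) ⟨_, hn, rfl⟩
      have h1 := hmul (toConv g) ((toConv g)⁻¹ * toConv g') x
      rw [← hev _ x, ← hev (_ * _) x, h0, add_zero, mul_inv_cancel_left] at h1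
      exact h1.symm
    have h1 : h b = l x := hl b x hb
    rw [LinearMap.sub_apply, ← h1, hev, ← hg₀, ← hb]
    exact sub_self _
  obtain ⟨n, hn, hn'⟩ := hν
  refine ⟨(toConv g₀ * n : Points k A).ofConv, ?_, fun x => ?_⟩
  · have := congrArg WithConv.ofConv (hcompmul (toConv g₀) n)
    rw [hn, mul_one] at this
    exact this.trans hg₀
  · rw [hmul, ← hev n, hn']
    simp [hev]

end PrimeField

end AffGroup

/-! ### The lifting theorem. -/

theorem proposition4 {k : Type u} [Field k]
    (hk : CharZero k ∨ ∃ p : ℕ, p.Prime ∧ Nat.card k = p)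
    {A B : Type u} [CommRing A] [HopfAlgebra k A] [CommRing B] [HopfAlgebra k B]
    (hG : AffGroup.IsProunipotent k A) (hH : AffGroup.IsProunipotent k B)
    (f : B →ₐc[k] A) (hf : Function.Injective f)
    (e : ℕ) (hrank : AffGroup.rank k A ≤ e)
    (h : Fin e → AffGroup.Points k B) (hgen : AffGroup.Generates k B (Set.range h)) :
    ∃ g : Fin e → AffGroup.Points k A,
      AffGroup.Generates k A (Set.range g) ∧ ∀ i, AffGroup.mapPoints f (g i) = h i := by
  open AffGroup in
  have hA := hG.isConilpotent
  have hB := hH.isConilpotent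
  obtain ⟨hfin, hdim⟩ := finite_primitives_of_rank_le hA hrank
  let fP : primitives k B →ₗ[k] primitives k A :=
    (f : B →ₗ[k] A).restrict fun x hx => map_mem_primitives f hx
  have hfP : Function.Injective fP := fun x y hxy =>
    Subtype.ext (hf (congrArg Subtype.val hxy))
  obtain ⟨l, hl, hlf⟩ := exists_injective_extension (W := Fin e → k) (by simpa using hdim) hfP
    ((generates_range_iff hB h).mp hgen)
  have hlift : ∀ i, ∃ g : A →ₐ[k] k, g.comp (f : B →ₐ[k] A) = (h i).ofConv ∧
      ∀ x : primitives k A, g x = l x i := by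
    intro i
    have hcompat : ∀ (b : B) (x : primitives k A), f b = x →
        (h i).ofConv b = (LinearMap.proj i ∘ₗ l) x := by
      intro b x hbx
      -- Compatibility need only be checked on characters of H, where `l` was chosen to extend
      -- evaluation at the h_i.
      have hb : b ∈ primitives k B := mem_primitives_of_map_mem hf (hbx ▸ x.2)
      obtain rfl : fP ⟨b, hb⟩ = x := Subtype.ext hbx
      exact (congrFun (LinearMap.congr_fun hlf ⟨b, hb⟩) i).symm
    rcases hk with hk | ⟨p, hp, hk⟩
    · exact exists_lift_of_charZero hA hB f hf _ (LinearMap.proj i ∘ₗ l) hcompat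
    · exact exists_lift_of_card_prime hp hk (hG.pow_eq hp hk) f hf _ (LinearMap.proj i ∘ₗ l) hcompat
  choose g hgf hgl using hlift
  refine ⟨fun i => WithConv.toConv (g i), ?_, fun i => WithConv.ext (hgf i)⟩
  rw [generates_range_iff hA]
  have : evalPrimitives (fun i => WithConv.toConv (g i)) = l := by
    ext x i
    exact hgl i x
  rw [this]
  exact hl
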